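/- Let $R$ be an integral domain. A finitely generated ideal $J$ of $R$ is called a GV-ideal if the natural map $R\to \operatorname{Hom}_R(J,R)$, $r\mapsto (x\mapsto rx)$, is an isomorphism. An $R$-module $M$ is GV-torsion-free if no nonzero element of $M$ is annihilated by a GV-ideal; a GV-torsion-free module $M$ is a $w$-module if $\operatorname{Ext}^1_R(R/J,M)=0$ for every GV-ideal $J$. An ideal that is a $w$-module is called a $w$-ideal, and $R$ is a DW-domain if every ideal of $R$ is a $w$-ideal. A maximal $w$-ideal is an ideal that is maximal among the proper $w$-ideals of $R$ (such an ideal is prime), and a sequence $0\to A\to B\to C\to 0$ of $R$-modules is $w$-exact if $0\to A_{\mathfrak p}\to B_{\mathfrak p}\to C_{\mathfrak p}\to 0$ is exact for every maximal $w$-ideal $\mathfrak p$. A submodule $A$ of an $R$-module $B$ is $w$-pure if $0\to A\to B\to B/A\to 0$ is $w$-exact and $0\to A\otimes_R M\to B\otimes_R M\to (B/A)\otimes_R M\to 0$ is $w$-exact for every $R$-module $M$. An $R$-module $A$ is absolutely $w$-pure if it is a $w$-pure submodule of every $R$-module containing it as a submodule. An $R$-module $M$ is $w$-FP-projective if $\operatorname{Ext}^1_R(M,A)=0$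 for every absolutely $w$-pure $R$-module $A$. Finally, $R$ is coherent if every finitely generated ideal of $R$ is finitely presented. Then $R$ is a coherent DW-domain if and only if every finitely generated torsion-free $R$-module is $w$-FP-projective. -/

import Mathlib

universe u

namespace WFP

open CategoryTheory CategoryTheory.Abelian

section Defs

variable (R : Type u) [CommRing R]

/-- The statement `Ext¹_R(M, N) = 0`. -/
def ExtOneVanishes (M N : Type u) [AddCommGroup M] [Module R M]
    [AddCommGroup N] [Module R N] : Prop :=
  Subsingleton (Ext (ModuleCat.of R M) (ModuleCat.of R N) 1)

variable {R} in
/-- `J` is a Glaz-Vasconcelos ideal: it is finitely generated and the natural homomorphism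
`R → Hom_R(J, R)`, `r ↦ (x ↦ r * x)`, is an isomorphism. -/
def IsGVIdeal (J : Ideal R) : Prop :=
  J.FG ∧ Function.Bijective (LinearMap.toSpanSingleton R (J →ₗ[R] R) J.subtype)

/-- `tor_GV(M) = 0`. -/
def IsGVTorsionFree (M : Type u) [AddCommGroup M] [Module R M] : Prop :=
  ∀ x : M, (∃ J : Ideal R, IsGVIdeal J ∧ ∀ a ∈ J, a • x = 0) → x = 0

/-- `M` is a `w`-module: it is GV-torsion-free and `Ext¹_R(R/J, M) = 0` for every GV-ideal `J`. -/
def IsWModule (M : Type u) [AddCommGroup M] [Module R M] : Prop :=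
  IsGVTorsionFree R M ∧ ∀ J : Ideal R, IsGVIdeal J → ExtOneVanishes R (R ⧸ J) M

/-- `R` is a DW-ring: every ideal of `R` is a `w`-ideal. -/
def IsDWRing : Prop := ∀ I : Ideal R, IsWModule R I

/-- `R` is coherent: every finitely generated ideal of `R` is finitely presented. -/
def IsCoherent : Prop := ∀ I : Ideal R, I.FG → Module.FinitePresentation R I

variable {R} in
/-- `p` is a maximal `w`-ideal: it is maximal among the proper `w`-ideals of `R`. -/
def IsMaximalWIdeal (p : Ideal R) : Prop :=
  Maximal (fun I : Ideal R => I ≠ ⊤ ∧ IsWModule R I) p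

end Defs

section Prime

variable {R : Type u} [CommRing R]

theorem IsGVIdeal.eq_zero {J : Ideal R} (hJ : IsGVIdeal J) {x : R}
    (hx : ∀ a ∈ J, a * x = 0) : x = 0 := by
  apply hJ.2.1
  ext a
  simpa [mul_comm] using hx a a.2

theorem isGVTorsionFree_ideal (I : Ideal R) : IsGVTorsionFree R I := by
  rintro x ⟨J, hJ, hx⟩
  ext
  exact hJ.eq_zero fun a ha => by simpa using congrArg Subtype.val (hx a ha)

/-- `Ext¹_R(R/J, M) = 0` if and only if every homomorphism `J → M` extends to `R`. -/
theorem extOneVanishes_quotient_iff (J : Ideal R) (M : Type u) [AddCommGroup M] [Module R M] :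
    ExtOneVanishes R (R ⧸ J) M ↔ ∀ f : J →ₗ[R] M, ∃ m : M, ∀ a : J, f a = (a : R) • m := by
  let S : ShortComplex (ModuleCat.{u} R) :=
    { X₁ := ModuleCat.of R J
      X₂ := ModuleCat.of R R
      X₃ := ModuleCat.of R (R ⧸ J)
      f := ModuleCat.ofHom J.subtype
      g := ModuleCat.ofHom J.mkQ
      zero := by ext x; exact Ideal.Quotient.eq_zero_iff_mem.2 x.2 }
  have hS : S.ShortExact := ModuleCat.shortComplex_shortExact S
    (LinearMap.exact_subtype_mkQ J) J.injective_subtype J.mkQ_surjective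
  have : Projective S.X₂ := inferInstanceAs (Projective (ModuleCat.of R R))
  constructor
  · intro h f
    obtain ⟨x₂, hx₂⟩ := Ext.contravariant_sequence_exact₁ hS (ModuleCat.of R M)
      (Ext.mk₀ (X := S.X₁) (ModuleCat.ofHom f)) (add_zero 1)
      ((show Subsingleton (Ext S.X₃ (ModuleCat.of R M) 1) from h).elim _ _)
    obtain ⟨g, rfl⟩ := (Ext.mk₀_bijective _ _).2 x₂
    rw [Ext.mk₀_comp_mk₀] at hx₂
    have hg := (Ext.mk₀_bijective _ _).1 hx₂
    refine ⟨g.hom (1 : R), fun a => ?_⟩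
    have h1 := congrArg (fun t => t.hom a) hg
    have h2 : g.hom (a : R) = f a := h1
    rw [← h2, ← map_smul]
    congr 1
    exact (mul_one (a : R)).symm
  · intro h
    refine subsingleton_of_forall_eq 0 fun e => ?_
    obtain ⟨x₁, hx₁⟩ := Ext.contravariant_sequence_exact₃ hS (ModuleCat.of R M) e
      (Ext.eq_zero_of_projective _) (add_zero 1)
    obtain ⟨f, rfl⟩ := (Ext.mk₀_bijective _ _).2 x₁
    obtain ⟨m, hm⟩ := h f.hom
    have hf : f = S.f ≫ ModuleCat.ofHom (LinearMap.toSpanSingleton R M m) := by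
      ext a
      exact hm a
    rw [← hx₁, hf, ← Ext.mk₀_comp_mk₀, ← Ext.comp_assoc_of_second_deg_zero]
    simp

theorem isWModule_ideal_iff (I : Ideal R) :
    IsWModule R I ↔ ∀ J : Ideal R, IsGVIdeal J → ∀ x : R, (∀ a ∈ J, a * x ∈ I) → x ∈ I := by
  constructor
  · rintro ⟨-, h⟩ J hJ x hx
    obtain ⟨m, hm⟩ := (extOneVanishes_quotient_iff J I).1 (h J hJ)
      ((LinearMap.toSpanSingleton R R x ∘ₗ J.subtype).codRestrict I fun a => by
        simpa using hx a a.2)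
    have h0 : x - m = 0 := hJ.eq_zero fun a ha => by
      have := congrArg Subtype.val (hm ⟨a, ha⟩)
      simp at this
      rw [mul_sub, this, sub_self]
    rw [sub_eq_zero.1 h0]
    exact m.2
  · refine fun h => ⟨isGVTorsionFree_ideal I, fun J hJ => ?_⟩
    rw [extOneVanishes_quotient_iff]
    intro f
    obtain ⟨x, hx⟩ := hJ.2.2 (I.subtype ∘ₗ f)
    have hx' : ∀ a : J, ((f a : I) : R) = a * x := fun a => by
      have := LinearMap.congr_fun hx a
      simpa [mul_comm] using this.symm
    refine ⟨⟨x, h J hJ x fun a ha => ?_⟩, fun a => Subtype.ext (hx' a)⟩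
    rw [← hx' ⟨a, ha⟩]
    exact (f ⟨a, ha⟩).2

/-- Every maximal `w`-ideal is prime. -/
theorem IsMaximalWIdeal.isPrime {p : Ideal R} (hp : IsMaximalWIdeal p) : p.IsPrime := by
  refine ⟨hp.prop.1, fun {a b} hab => or_iff_not_imp_left.2 fun ha => ?_⟩
  let q : Ideal R := Submodule.comap (LinearMap.toSpanSingleton R R a) p
  have hq : ∀ x, x ∈ q ↔ x * a ∈ p := fun x => by simp [q]
  have hpq : p ≤ q := fun x hx => (hq x).2 (p.mul_mem_right a hx)
  have hqw : IsWModule R q := by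
    rw [isWModule_ideal_iff]
    intro J hJ x hx
    rw [hq]
    refine (isWModule_ideal_iff p).1 hp.prop.2 J hJ _ fun c hc => ?_
    rw [← mul_assoc]
    exact (hq _).1 (hx c hc)
  have hqt : q ≠ ⊤ := fun h => ha (by
    have : (1 : R) ∈ q := h ▸ Submodule.mem_top
    simpa using (hq 1).1 this)
  exact hp.le_of_ge ⟨hqt, hqw⟩ hpq ((hq b).2 (by rwa [mul_comm]))

end Prime

section Pure

variable {R : Type u} [CommRing R]

/-- The sequence `0 → A → B → C → 0` given by `f` and `g` is `w`-exact: it is exact after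
localization at every maximal `w`-ideal `p`. The binder `[p.IsPrime]` only provides the
localization: by `IsMaximalWIdeal.isPrime` it excludes no maximal `w`-ideal. -/
def IsWExact {A B C : Type u} [AddCommGroup A] [Module R A] [AddCommGroup B] [Module R B]
    [AddCommGroup C] [Module R C] (f : A →ₗ[R] B) (g : B →ₗ[R] C) : Prop :=
  ∀ (p : Ideal R) [p.IsPrime], IsMaximalWIdeal p →
    Function.Injective (LocalizedModule.map p.primeCompl f) ∧
    Function.Exact (LocalizedModule.map p.primeCompl f) (LocalizedModule.map p.primeCompl g) ∧
    Function.Surjective (LocalizedModule.map p.primeCompl g)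

/-- The sequence `0 → A → B → C → 0` given by `f` and `g` is `w`-pure exact. -/
def IsWPureExact {A B C : Type u} [AddCommGroup A] [Module R A] [AddCommGroup B] [Module R B]
    [AddCommGroup C] [Module R C] (f : A →ₗ[R] B) (g : B →ₗ[R] C) : Prop :=
  IsWExact f g ∧ ∀ (M : Type u) [AddCommGroup M] [Module R M],
    IsWExact (f.rTensor M) (g.rTensor M)

/-- `A` is a `w`-pure submodule of `B`. -/
def IsWPureSubmodule {B : Type u} [AddCommGroup B] [Module R B] (A : Submodule R B) : Prop :=
  IsWPureExact A.subtype A.mkQ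

variable (R)

/-- `A` is absolutely `w`-pure: it is a `w`-pure submodule of every module that contains it,
that is, its image under every injective homomorphism `A → B` is a `w`-pure submodule of `B`. -/
def IsAbsolutelyWPure (A : Type u) [AddCommGroup A] [Module R A] : Prop :=
  ∀ (B : Type u) [AddCommGroup B] [Module R B] (i : A →ₗ[R] B),
    Function.Injective i → IsWPureSubmodule (LinearMap.range i)

/-- `M` is `w`-FP-projective: `Ext¹_R(M, A) = 0` for every absolutely `w`-pure module `A`. -/
def IsWFPProjective (M : Type u) [AddCommGroup M] [Module R M] : Prop :=
  ∀ (A : Type u) [AddCommGroup A] [Module R A], IsAbsolutelyWPure R A → ExtOneVanishes R M A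

end Pure

end WFP

/-! Over a DW-ring every maximal ideal is a maximal `w`-ideal, so absolutely `w`-pure modules are
absolutely pure, and `Ext¹` from a finitely presented module into them vanishes. Over a coherent
domain a finitely generated torsion-free module embeds in some `Rⁿ` and is therefore finitely
presented.

Conversely, only finitely generated ideals are tested, against two kinds of modules. A module of
eventually vanishing families, absolutely pure, forces first syzygies to be finitely generated: this
gives coherence (`fg_ker_of_isWFPProjective`). Quotients `K/mK` of syzygies, killed by a GV-ideal `J
≤ m`, make `J` principal locally at `m`; since every map `J → R` is a multiplication, no such `m`
exists. So `J = R`, and `R` is DW. -/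

namespace WFP

open CategoryTheory CategoryTheory.Abelian TensorProduct

/-! ### `Ext¹` through projective presentations -/

section ExtOne

variable {R : Type u} [CommRing R]

/-- For a projective presentation `g : P → M`, the group `Ext¹_R(M, N)` vanishes if and only if
every homomorphism `ker g → N` extends to `P`. -/
theorem extOneVanishes_iff_extends {M P : Type u} [AddCommGroup M] [Module R M]
    [AddCommGroup P] [Module R P] [Module.Projective R P] (g : P →ₗ[R] M)
    (hg : Function.Surjective g) (N : Type u) [AddCommGroup N] [Module R N] :
    ExtOneVanishes R M N ↔
      ∀ f : LinearMap.ker g →ₗ[R] N, ∃ h : P →ₗ[R] N, ∀ k : LinearMap.ker g, h k = f k := by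
  let S : ShortComplex (ModuleCat.{u} R) :=
    { X₁ := ModuleCat.of R (LinearMap.ker g)
      X₂ := ModuleCat.of R P
      X₃ := ModuleCat.of R M
      f := ModuleCat.ofHom (LinearMap.ker g).subtype
      g := ModuleCat.ofHom g
      zero := by ext x; exact x.2 }
  have hS : S.ShortExact := ModuleCat.shortComplex_shortExact S
    (LinearMap.exact_subtype_ker_map g) (Submodule.injective_subtype _) hg
  have : Projective S.X₂ := (IsProjective.iff_projective P).1 inferInstance
  constructor
  · intro h f
    obtain ⟨x₂, hx₂⟩ := Ext.contravariant_sequence_exact₁ hS (ModuleCat.of R N)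
      (Ext.mk₀ (X := S.X₁) (ModuleCat.ofHom f)) (add_zero 1)
      ((show Subsingleton (Ext S.X₃ (ModuleCat.of R N) 1) from h).elim _ _)
    obtain ⟨h', rfl⟩ := (Ext.mk₀_bijective _ _).2 x₂
    rw [Ext.mk₀_comp_mk₀] at hx₂
    have hg := (Ext.mk₀_bijective _ _).1 hx₂
    exact ⟨h'.hom, fun a => congrArg (fun t => t.hom a) hg⟩
  · intro h
    refine subsingleton_of_forall_eq 0 fun e => ?_
    -- As `P` is projective, every class is the connecting image of some map `ker g → N`; it dies
    -- when that map extends to `P`.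
    obtain ⟨x₁, hx₁⟩ := Ext.contravariant_sequence_exact₃ hS (ModuleCat.of R N) e
      (Ext.eq_zero_of_projective _) (add_zero 1)
    obtain ⟨f, rfl⟩ := (Ext.mk₀_bijective _ _).2 x₁
    obtain ⟨m, hm⟩ := h f.hom
    have hf : f = S.f ≫ ModuleCat.ofHom m := by
      ext a
      exact (hm a).symm
    rw [← hx₁, hf, ← Ext.mk₀_comp_mk₀, ← Ext.comp_assoc_of_second_deg_zero]
    simp

/-- Every module embeds into an injective module. -/
theorem exists_injective_embedding (M : Type u) [AddCommGroup M] [Module R M] :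
    ∃ (E : Type u) (_ : AddCommGroup E) (_ : Module R E) (i : M →ₗ[R] E),
      Module.Injective R E ∧ Function.Injective i := by
  obtain ⟨⟨I, hI, f, hf⟩⟩ := EnoughInjectives.presentation (ModuleCat.of R M)
  exact ⟨I, inferInstance, inferInstance, f.hom,
    Module.injective_module_of_injective_object R I, (ModuleCat.mono_iff_injective f).1 hf⟩

end ExtOne

/-! ### Purity and absolutely `w`-pure modules -/

section Purity

variable {R : Type u} [CommRing R]

/-- If `i : A → B` stays injective after tensoring, a finite linear system over `A` that is
solvable in `B` is solvable in `A`. -/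
theorem exists_solution_of_rTensor_injective {A B : Type u} [AddCommGroup A] [Module R A]
    [AddCommGroup B] [Module R B] (i : A →ₗ[R] B)
    (hi : ∀ (M : Type u) [AddCommGroup M] [Module R M], Function.Injective (i.rTensor M))
    {m n : ℕ} (r : Matrix (Fin m) (Fin n) R) (a : Fin m → A) (b : Fin n → B)
    (hab : ∀ k, ∑ j, r k j • b j = i (a k)) :
    ∃ a' : Fin n → A, ∀ k, ∑ j, r k j • a' j = a k := by
  let T : (Fin n → R) →ₗ[R] (Fin m → R) := r.mulVecLin
  let q := (LinearMap.range T).mkQ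
  -- The right-hand sides form a tensor `z`; the system is solvable once `z` dies in `A ⊗ coker T`.
  let z : A ⊗[R] (Fin m → R) := ∑ k, a k ⊗ₜ Pi.single k 1
  have hT : ∀ j, T (Pi.single j 1) = ∑ k, r k j • Pi.single k (1 : R) := fun j => by
    ext k
    simp [T, Finset.sum_apply, Pi.single_apply]
  have hz : q.lTensor A z = 0 := by
    apply hi
    simp only [z, map_sum, map_zero, LinearMap.lTensor_tmul, LinearMap.rTensor_tmul, ← hab,
      TensorProduct.sum_tmul]
    rw [Finset.sum_comm]
    refine Finset.sum_eq_zero fun j _ => ?_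
    simp only [TensorProduct.smul_tmul, ← TensorProduct.tmul_sum]
    have : ∑ k, r k j • q (Pi.single k 1) = 0 := by
      simp only [← map_smul, ← map_sum, ← hT]
      exact (Submodule.Quotient.mk_eq_zero _).2 ⟨_, rfl⟩
    rw [this, TensorProduct.tmul_zero]
  obtain ⟨w, hw⟩ := (lTensor_exact A (f := T) (g := q)
    (LinearMap.exact_map_mkQ_range T) (Submodule.mkQ_surjective _) z).1 hz
  let e : ∀ l : ℕ, A ⊗[R] (Fin l → R) →ₗ[R] (Fin l → A) := fun l =>
    (TensorProduct.piScalarRight R R A (Fin l)).toLinearMap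
  have key : ∀ w k, e m (T.lTensor A w) k = ∑ j, r k j • e n w j := by
    intro w k
    induction w with
    | zero => simp
    | add x y hx hy => simp only [map_add, Pi.add_apply, hx, hy, smul_add, Finset.sum_add_distrib]
    | tmul x y =>
      simp [e, T, Matrix.mulVec, dotProduct, Finset.sum_smul, mul_smul]
  refine ⟨e n w, fun k => ?_⟩
  rw [← key, hw]
  simp [e, z, Finset.sum_apply, Pi.single_apply]

/-- Tensoring is right exact and localization exact, so only injectivity on the left can fail. -/
theorem isWPureSubmodule_of_injective {B : Type u} [AddCommGroup B] [Module R B]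
    (A : Submodule R B)
    (h : ∀ (M : Type u) [AddCommGroup M] [Module R M] (p : Ideal R) [p.IsPrime],
      IsMaximalWIdeal p →
      Function.Injective (LocalizedModule.map p.primeCompl (A.subtype.rTensor M))) :
    IsWPureSubmodule A := by
  refine ⟨fun p _ hp => ⟨LocalizedModule.map_injective _ _ A.injective_subtype,
    LocalizedModule.map_exact _ _ _ (LinearMap.exact_subtype_mkQ A),
    LocalizedModule.map_surjective _ _ A.mkQ_surjective⟩, fun M _ _ p _ hp => ⟨h M p hp, ?_, ?_⟩⟩
  · exact LocalizedModule.map_exact _ _ _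
      (rTensor_exact M (LinearMap.exact_subtype_mkQ A) A.mkQ_surjective)
  · exact LocalizedModule.map_surjective _ _ (LinearMap.rTensor_surjective M A.mkQ_surjective)

theorem rTensor_range_subtype_injective_iff {A B : Type u} [AddCommGroup A] [Module R A]
    [AddCommGroup B] [Module R B] (i : A →ₗ[R] B) (hi : Function.Injective i)
    (M : Type u) [AddCommGroup M] [Module R M] :
    Function.Injective ((LinearMap.range i).subtype.rTensor M) ↔
      Function.Injective (i.rTensor M) := by
  let e := LinearEquiv.ofInjective i hi
  have h : i = (LinearMap.range i).subtype ∘ₗ e.toLinearMap := by ext; rfl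
  have h' : i.rTensor M =
      (LinearMap.range i).subtype.rTensor M ∘ₗ (e.rTensor M).toLinearMap := by
    conv_lhs => rw [h, LinearMap.rTensor_comp]
    rfl
  rw [h', LinearMap.coe_comp]
  exact (Function.Injective.of_comp_iff' _ (e.rTensor M).bijective).symm

/-- An absolutely pure module is absolutely `w`-pure. -/
theorem isAbsolutelyWPure_of_rTensor_injective (A : Type u) [AddCommGroup A] [Module R A]
    (h : ∀ (B : Type u) [AddCommGroup B] [Module R B] (i : A →ₗ[R] B), Function.Injective i →
      ∀ (M : Type u) [AddCommGroup M] [Module R M], Function.Injective (i.rTensor M)) :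
    IsAbsolutelyWPure R A := fun B _ _ i hi =>
  isWPureSubmodule_of_injective _ fun M _ _ _ _ _ => LocalizedModule.map_injective _ _
    ((rTensor_range_subtype_injective_iff i hi M).2 (h B i hi M))

/-- A module annihilated by a GV-ideal is absolutely `w`-pure. -/
theorem isAbsolutelyWPure_of_gv_smul_eq_zero (A : Type u) [AddCommGroup A] [Module R A]
    {J : Ideal R} (hJ : IsGVIdeal J) (h : ∀ a ∈ J, ∀ x : A, a • x = 0) :
    IsAbsolutelyWPure R A := fun B _ _ i hi =>
  isWPureSubmodule_of_injective _ fun M _ _ p _ hp => by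
    -- A proper `w`-ideal contains no GV-ideal; hence some `s ∈ J` is inverted at `p` and kills the
    -- source.
    obtain ⟨s, hsJ, hsp⟩ : ∃ s ∈ J, s ∉ p := by
      by_contra! hJp
      exact hp.prop.1 ((Ideal.eq_top_iff_one p).2
        ((isWModule_ideal_iff p).1 hp.prop.2 J hJ 1 fun a ha => by simpa using hJp a ha))
    have hs : ∀ z : LinearMap.range i ⊗[R] M, s • z = 0 := fun z => by
      induction z with
      | zero => simp
      | add x y hx hy => rw [smul_add, hx, hy, add_zero]
      | tmul x y =>
        obtain ⟨_, a, rfl⟩ := x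
        rw [TensorProduct.smul_tmul']
        have : s • (⟨i a, a, rfl⟩ : LinearMap.range i) = 0 :=
          Subtype.ext (by simp [← map_smul, h s hsJ a])
        rw [this, TensorProduct.zero_tmul]
    have : Subsingleton (LocalizedModule p.primeCompl (LinearMap.range i ⊗[R] M)) :=
      LocalizedModule.subsingleton_iff.2 fun z => ⟨s, hsp, hs z⟩
    exact Function.injective_of_subsingleton _

end Purity
end WFP

namespace WFP

/-! ### Torsion-free modules over coherent domains -/

section Coherent

variable {R : Type u} [CommRing R]

theorem IsCoherent.finitePresentation_of_injective_pi (hR : IsCoherent R) (n : ℕ) :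
    ∀ (N : Type u) [AddCommGroup N] [Module R N] [Module.Finite R N] (f : N →ₗ[R] (Fin n → R)),
      Function.Injective f → Module.FinitePresentation R N := by
  induction n with
  | zero =>
    intro N _ _ _ f hf
    have : Subsingleton N := hf.subsingleton
    infer_instance
  | succ n ih =>
    intro N _ _ _ f hf
    -- The image of the last coordinate is a finitely generated ideal; the kernel embeds in `Rⁿ`.
    let g : N →ₗ[R] R := LinearMap.proj (Fin.last n) ∘ₗ f
    have : Module.FinitePresentation R (LinearMap.range g) :=
      hR (LinearMap.range g) (Module.Finite.iff_fg.1 inferInstance)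
    have hK : Module.Finite R (LinearMap.ker g.rangeRestrict) := Module.Finite.iff_fg.2
      (Module.FinitePresentation.fg_ker g.rangeRestrict g.surjective_rangeRestrict)
    have := ih (LinearMap.ker g.rangeRestrict)
      (LinearMap.funLeft R R Fin.castSucc ∘ₗ f ∘ₗ (LinearMap.ker g.rangeRestrict).subtype) <| by
        rw [← LinearMap.ker_eq_bot, LinearMap.ker_eq_bot']
        intro x hx
        have h0 : f x = 0 := funext fun j => by
          refine Fin.lastCases ?_ (fun k => ?_) j
          · exact congrArg Subtype.val x.2
          · exact congrFun hx k
        exact Subtype.ext (hf (by simpa using h0))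
    exact Module.finitePresentation_of_ker g.rangeRestrict g.surjective_rangeRestrict

/-- A finitely generated torsion-free module over a domain embeds into a finite free module. -/
theorem exists_injective_pi [IsDomain R] (M : Type u) [AddCommGroup M] [Module R M]
    [Module.Finite R M] [Module.IsTorsionFree R M] :
    ∃ (n : ℕ) (f : M →ₗ[R] (Fin n → R)), Function.Injective f := by
  let S := nonZeroDivisors R
  let K := FractionRing R
  let V := LocalizedModule S M
  let ι : M →ₗ[R] V := LocalizedModule.mkLinearMap S M
  have hι : Function.Injective ι := by
    rw [← LinearMap.ker_eq_bot, LinearMap.ker_eq_bot']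
    intro x hx
    obtain ⟨s, hs⟩ := (IsLocalizedModule.eq_zero_iff S ι).1 hx
    exact (smul_eq_zero_iff_right (nonZeroDivisors.coe_ne_zero s)).1 hs
  have : Module.Finite K V := Module.Finite.of_isLocalizedModule S ι
  let b := Module.finBasis K V
  let φ : Fin (Module.finrank K V) → M →ₗ[R] K := fun j => (b.coord j).restrictScalars R ∘ₗ ι
  -- Clear denominators in each coordinate of `M` over the fraction field.
  have hφ : ∀ j, ∃ (c : R) (g : M →ₗ[R] R), c ≠ 0 ∧
      ∀ x, algebraMap R K (g x) = c • φ j x := fun j => by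
    obtain ⟨c, hc, h⟩ := FractionalIdeal.isFractional_of_fg (S := S)
      (I := LinearMap.range (φ j)) (Module.Finite.iff_fg.1 inferInstance)
    have hinj : Function.Injective (Algebra.linearMap R K) := IsFractionRing.injective R K
    let e := LinearEquiv.ofInjective (Algebra.linearMap R K) hinj
    let g := (c • φ j).codRestrict (LinearMap.range (Algebra.linearMap R K)) fun x => by
      obtain ⟨r, hr⟩ := h (φ j x) ⟨x, rfl⟩
      exact ⟨r, hr⟩
    refine ⟨c, e.symm.toLinearMap ∘ₗ g, nonZeroDivisors.ne_zero hc, fun x => ?_⟩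
    exact congrArg Subtype.val (e.apply_symm_apply (g x))
  choose c g hc hg using hφ
  refine ⟨_, LinearMap.pi g, ?_⟩
  rw [← LinearMap.ker_eq_bot, LinearMap.ker_eq_bot']
  intro x hx
  refine hι (b.ext_elem fun j => ?_)
  have h1 : c j • φ j x = 0 := by
    rw [← hg, show g j x = 0 from congrFun hx j, map_zero]
  have h2 : b.repr (ι x) j = 0 := (smul_eq_zero_iff_right (hc j)).1 h1
  rw [h2, map_zero, map_zero, Finsupp.zero_apply]

end Coherent

section DW

variable {R : Type u} [CommRing R]

theorem IsDWRing.isMaximalWIdeal (hR : IsDWRing R) (p : Ideal R) [hp : p.IsMaximal] :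
    IsMaximalWIdeal p :=
  ⟨⟨hp.ne_top, hR p⟩, fun _ hI hpI => (hp.eq_of_le hI.1 hpI).ge⟩

theorem isDWRing_of_gv_eq_top (h : ∀ J : Ideal R, IsGVIdeal J → J = ⊤) : IsDWRing R := fun I =>
  (isWModule_ideal_iff I).2 fun J hJ x hx => by
    simpa using hx 1 (h J hJ ▸ Submodule.mem_top)

end DW
end WFP

namespace WFP

open TensorProduct

/-! ### Finitely presented modules over DW-rings; coherence -/

section Main

variable {R : Type u} [CommRing R]

theorem IsDWRing.rTensor_injective (hR : IsDWRing R) {A B : Type u} [AddCommGroup A] [Module R A]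
    [AddCommGroup B] [Module R B] (hA : IsAbsolutelyWPure R A) (i : A →ₗ[R] B)
    (hi : Function.Injective i) (M : Type u) [AddCommGroup M] [Module R M] :
    Function.Injective (i.rTensor M) :=
  (rTensor_range_subtype_injective_iff i hi M).1 <|
    injective_of_localized_maximal _ fun p _ => ((hA B i hi).2 M p (hR.isMaximalWIdeal p)).1

/-- Over a DW-ring, finitely presented modules are `w`-FP-projective. -/
theorem IsDWRing.isWFPProjective_of_finitePresentation (hR : IsDWRing R) (M : Type u)
    [AddCommGroup M] [Module R M] [Module.FinitePresentation R M] : IsWFPProjective R M := by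
  intro A _ _ hA
  obtain ⟨n, g, hg⟩ := Module.Finite.exists_fin' R M
  rw [extOneVanishes_iff_extends g hg]
  intro f
  obtain ⟨E, _, _, i, hE, hi⟩ := exists_injective_embedding (R := R) A
  obtain ⟨h, hh⟩ := hE.out (LinearMap.ker g).subtype (Submodule.injective_subtype _) (i ∘ₗ f)
  have : Module.Finite R (LinearMap.ker g) :=
    Module.Finite.iff_fg.2 (Module.FinitePresentation.fg_ker g hg)
  obtain ⟨m, k, hk⟩ := Module.Finite.exists_fin (R := R) (M := LinearMap.ker g)
  -- Extending `f` to `P` means solving one equation per generator of `ker g`; the injective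
  -- hull-like module `E` supplies a solution, and purity brings it down to `A`.
  obtain ⟨a, ha⟩ := exists_solution_of_rTensor_injective i
    (fun N _ _ => hR.rTensor_injective hA i hi N) (fun l j => (k l : Fin n → R) j)
    (fun l => f (k l)) (fun j => h (Pi.single j 1)) (fun l => by
      have h1 := hh (k l)
      rw [Submodule.subtype_apply, ← Finset.univ_sum_single (k l : Fin n → R), map_sum] at h1
      rw [← LinearMap.comp_apply, ← h1]
      refine Finset.sum_congr rfl fun j _ => ?_
      rw [← map_smul, ← Pi.single_smul, smul_eq_mul, mul_one])
  refine ⟨Fintype.linearCombination R a, fun x => ?_⟩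
  have heq : Fintype.linearCombination R a ∘ₗ (LinearMap.ker g).subtype = f := by
    refine LinearMap.ext_on_range hk fun l => ?_
    simpa [Fintype.linearCombination_apply] using ha l
  exact LinearMap.congr_fun heq x

/-- A finitely generated `w`-FP-projective module has finitely generated first syzygies. -/
theorem fg_ker_of_isWFPProjective {M P : Type u} [AddCommGroup M] [Module R M]
    [AddCommGroup P] [Module R P] [Module.Projective R P] [Module.Finite R P] (g : P →ₗ[R] M)
    (hg : Function.Surjective g) (hM : IsWFPProjective R M) : (LinearMap.ker g).FG := by
  let K := LinearMap.ker g
  let ι := {S : Submodule R K // S.FG}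
  choose E iE₁ iE₂ i hE hi using fun S : ι => exists_injective_embedding (R := R) (K ⧸ S.1)
  -- Families that vanish at all `S` beyond some finitely generated `S₀`.
  let A : Submodule R (∀ S, E S) :=
    { carrier := {t | ∃ S₀ : ι, ∀ S, S₀ ≤ S → t S = 0}
      zero_mem' := ⟨⟨⊥, Submodule.fg_bot⟩, fun _ _ => rfl⟩
      add_mem' := by
        rintro s t ⟨S, hS⟩ ⟨T, hT⟩
        exact ⟨⟨S.1 ⊔ T.1, S.2.sup T.2⟩, fun U hU => by
          rw [Pi.add_apply, hS U (le_sup_left.trans hU), hT U (le_sup_right.trans hU), add_zero]⟩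
      smul_mem' := by
        rintro c t ⟨T, hT⟩
        exact ⟨T, fun U hU => by rw [Pi.smul_apply, hT U hU, smul_zero]⟩ }
  have bound : ∀ N : Submodule R A, N.FG →
      ∃ S₀ : ι, ∀ t ∈ N, ∀ S, S₀ ≤ S → (t : ∀ S, E S) S = 0 := by
    intro N hN
    induction N, hN using Submodule.fg_induction with
    | singleton x =>
      obtain ⟨S₀, h⟩ := x.2
      refine ⟨S₀, fun t ht S hS => ?_⟩
      obtain ⟨c, rfl⟩ := Submodule.mem_span_singleton.1 ht
      simp [h S hS]
    | sup N₁ N₂ _ _ h₁ h₂ =>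
      obtain ⟨S, hS⟩ := h₁
      obtain ⟨T, hT⟩ := h₂
      refine ⟨⟨S.1 ⊔ T.1, S.2.sup T.2⟩, fun t ht U hU => ?_⟩
      obtain ⟨x, hx, y, hy, rfl⟩ := Submodule.mem_sup.1 ht
      simp [hS x hx U (le_sup_left.trans hU), hT y hy U (le_sup_right.trans hU)]
  have hpure : ∀ (N : Type u) [AddCommGroup N] [Module R N],
      Function.Injective (A.subtype.rTensor N) := by
    intro N _ _
    refine (injective_iff_map_eq_zero _).2 fun z hz => ?_
    obtain ⟨A', hA', hz'⟩ :=
      TensorProduct.exists_finite_submodule_left_of_setFinite {z} (Set.finite_singleton z)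
    obtain ⟨z', rfl⟩ := hz' rfl
    obtain ⟨S₀, hS₀⟩ := bound A' (Module.Finite.iff_fg.1 hA')
    classical
    -- Truncation beyond `S₀` maps the whole product into `A` and fixes `A'`, so the tensor `z` must
    -- already vanish.
    let π : (∀ S, E S) →ₗ[R] A :=
      (LinearMap.pi fun S => if S₀ ≤ S then 0 else LinearMap.proj S).codRestrict A
        fun t => ⟨S₀, fun S hS => by simp [hS]⟩
    have hπ : (π ∘ₗ A.subtype) ∘ₗ A'.subtype = A'.subtype := by
      refine LinearMap.ext fun t => Subtype.ext (funext fun S => ?_)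
      by_cases hS : S₀ ≤ S
      · simp [π, hS, hS₀ t t.2 S hS]
      · simp [π, hS]
    have h1 := congrArg (π.rTensor N) hz
    rwa [map_zero, ← LinearMap.rTensor_comp_apply, ← LinearMap.rTensor_comp_apply, hπ] at h1
  have hA : IsAbsolutelyWPure R A := isAbsolutelyWPure_of_rTensor_injective A
    fun B _ _ j hj N _ _ => by
      obtain ⟨h, hh⟩ := (inferInstance : Module.Injective R (∀ S, E S)).out j hj A.subtype
      have h1 : A.subtype = h ∘ₗ j := LinearMap.ext fun x => (hh x).symm
      have h2 := hpure N
      rw [h1, LinearMap.rTensor_comp, LinearMap.coe_comp] at h2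
      exact h2.of_comp
  let f : K →ₗ[R] A := (LinearMap.pi fun S => i S ∘ₗ S.1.mkQ).codRestrict A fun x =>
    ⟨⟨R ∙ x, Submodule.fg_span_singleton x⟩, fun S hS => by
      have : S.1.mkQ x = 0 :=
        (Submodule.Quotient.mk_eq_zero _).2 (hS (Submodule.mem_span_singleton_self x))
      simp [this]⟩
  obtain ⟨h, hh⟩ := (extOneVanishes_iff_extends g hg A).1 (hM A hA) f
  -- Since `P` is finitely generated, one `S` bounds the whole image of `h`; then `K → K/S` is zero.
  obtain ⟨S, hS⟩ := bound (LinearMap.range h) (Module.Finite.iff_fg.1 inferInstance)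
  have htop : S.1 = ⊤ := by
    refine Submodule.eq_top_iff'.2 fun x => ?_
    have h1 := hS (h x) ⟨x, rfl⟩ S le_rfl
    rw [hh x] at h1
    exact (Submodule.Quotient.mk_eq_zero _).1 (hi S (h1.trans (map_zero _).symm))
  exact Module.Finite.iff_fg.1 ⟨htop ▸ S.2⟩

theorem isCoherent_of_isWFPProjective (h : ∀ I : Ideal R, I.FG → IsWFPProjective R I) :
    IsCoherent R := fun I hI => by
  have : Module.Finite R I := Module.Finite.iff_fg.2 hI
  obtain ⟨n, g, hg⟩ := Module.Finite.exists_fin' R I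
  exact Module.finitePresentation_of_surjective g hg (fg_ker_of_isWFPProjective g hg (h I hI))

end Main
end WFP

namespace WFP

/-! ### GV-ideals are trivial -/

section Main

variable {R : Type u} [CommRing R]

/-- If all finitely generated ideals are `w`-FP-projective, any two elements are comparable for
divisibility locally at a maximal ideal containing a GV-ideal. -/
theorem exists_notMem_mul_eq_or_mul_eq (H : ∀ I : Ideal R, I.FG → IsWFPProjective R I)
    {J : Ideal R} (hJ : IsGVIdeal J) {m : Ideal R} (hm : m ≠ ⊤) (hJm : J ≤ m) (a b : R) :
    ∃ s, s ∉ m ∧ ((∃ c, s * a = c * b) ∨ ∃ c, s * b = c * a) := by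
  by_contra! hno
  let g₀ : R × R →ₗ[R] R :=
    (LinearMap.toSpanSingleton R R a).coprod (LinearMap.toSpanSingleton R R b)
  have hg₀ : ∀ x y, g₀ (x, y) = x * a + y * b := fun x y => by simp [g₀]
  let g := g₀.rangeRestrict
  have hI : IsWFPProjective R (LinearMap.range g₀) :=
    H (LinearMap.range g₀) (Module.Finite.iff_fg.1 inferInstance)
  let K := LinearMap.ker g
  have hK : K.FG := fg_ker_of_isWFPProjective g g₀.surjective_rangeRestrict hI
  have hKmem : ∀ x y, (x, y) ∈ K ↔ x * a + y * b = 0 := fun x y => by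
    rw [← hg₀, LinearMap.mem_ker]
    exact Subtype.ext_iff
  let A := K ⧸ (m • ⊤ : Submodule R K)
  have hA0 : ∀ r ∈ m, ∀ z : A, r • z = 0 := fun r hr z => by
    obtain ⟨k, rfl⟩ := Submodule.mkQ_surjective _ z
    rw [← map_smul]
    exact (Submodule.Quotient.mk_eq_zero _).2 (Submodule.smul_mem_smul hr Submodule.mem_top)
  obtain ⟨h, hh⟩ := (extOneVanishes_iff_extends g g₀.surjective_rangeRestrict A).1
    (hI A (isAbsolutelyWPure_of_gv_smul_eq_zero A hJ fun r hr => hA0 r (hJm hr)))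
    (m • ⊤ : Submodule R K).mkQ
  -- Without local divisibility, `K ⊆ m × m`, so the extension `h` kills `K` and `K = mK`.
  have hle : (⊤ : Submodule R K) ≤ m • ⊤ := fun k _ => by
    obtain ⟨⟨x, y⟩, hk⟩ := k
    have hxy := (hKmem x y).1 hk
    have hx : x ∈ m := by
      by_contra hx
      exact (hno x hx).1 (-y) (by linear_combination hxy)
    have hy : y ∈ m := by
      by_contra hy
      exact (hno y hy).2 (-x) (by linear_combination hxy)
    refine (Submodule.Quotient.mk_eq_zero _).1 ((hh ⟨(x, y), hk⟩).symm.trans ?_)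
    have : (x, y) = x • ((1, 0) : R × R) + y • ((0, 1) : R × R) := by simp
    simp only [this, map_add, map_smul, hA0 x hx, hA0 y hy, add_zero]
  obtain ⟨r, hr, hr0⟩ := Submodule.exists_sub_one_mem_and_smul_eq_zero_of_fg_of_le_smul m
    (⊤ : Submodule R K) ((Module.Finite.iff_fg.2 hK).fg_top) hle
  have hrm : r ∉ m := fun h => hm ((Ideal.eq_top_iff_one m).2 (by simpa using m.sub_mem h hr))
  -- Nakayama's `r` kills the relation `(b, -a)`, so `r * a = 0`, a trivial divisibility.
  have h1 := congrArg (fun k : K => (k : R × R).2)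
    (hr0 ⟨(b, -a), (hKmem _ _).2 (by ring)⟩ Submodule.mem_top)
  have h2 : r * -a = 0 := h1
  exact (hno r hrm).1 0 (by linear_combination -h2)

/-- Pairwise comparability at `m` lets one generator absorb the others. -/
theorem exists_notMem_mul_eq_of_fg (H : ∀ I : Ideal R, I.FG → IsWFPProjective R I)
    {J : Ideal R} (hJ : IsGVIdeal J) {m : Ideal R} [hm : m.IsPrime] (hJm : J ≤ m) (I : Ideal R)
    (hI : I.FG) : ∃ b ∈ I, ∃ s, s ∉ m ∧ ∀ x ∈ I, ∃ c, s * x = c * b := by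
  induction I, hI using Submodule.fg_induction with
  | singleton b =>
    refine ⟨b, Submodule.mem_span_singleton_self b, 1, hm.one_notMem, fun x hx => ?_⟩
    obtain ⟨c, rfl⟩ := Submodule.mem_span_singleton.1 hx
    exact ⟨c, one_mul _⟩
  | sup I₁ I₂ _ _ h₁ h₂ =>
    obtain ⟨b₁, hb₁, s₁, hs₁, h₁⟩ := h₁
    obtain ⟨b₂, hb₂, s₂, hs₂, h₂⟩ := h₂
    obtain ⟨t, ht, h⟩ := exists_notMem_mul_eq_or_mul_eq H hJ hm.ne_top hJm b₁ b₂
    have hs : s₁ * s₂ * t ∉ m := hm.mul_notMem (hm.mul_notMem hs₁ hs₂) ht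
    rcases h with ⟨c, hc⟩ | ⟨c, hc⟩
    · refine ⟨b₂, le_sup_right (a := I₁) hb₂, _, hs, fun x hx => ?_⟩
      obtain ⟨x₁, hx₁, x₂, hx₂, rfl⟩ := Submodule.mem_sup.1 hx
      obtain ⟨c₁, hc₁⟩ := h₁ x₁ hx₁
      obtain ⟨c₂, hc₂⟩ := h₂ x₂ hx₂
      exact ⟨s₂ * c₁ * c + s₁ * t * c₂, by
        linear_combination s₂ * t * hc₁ + s₁ * t * hc₂ + s₂ * c₁ * hc⟩
    · refine ⟨b₁, le_sup_left (b := I₂) hb₁, _, hs, fun x hx => ?_⟩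
      obtain ⟨x₁, hx₁, x₂, hx₂, rfl⟩ := Submodule.mem_sup.1 hx
      obtain ⟨c₁, hc₁⟩ := h₁ x₁ hx₁
      obtain ⟨c₂, hc₂⟩ := h₂ x₂ hx₂
      exact ⟨s₂ * t * c₁ + s₁ * c₂ * c, by
        linear_combination s₂ * t * hc₁ + s₁ * t * hc₂ + s₁ * c₂ * hc⟩

theorem IsGVIdeal.eq_top_of_isWFPProjective [IsDomain R] (H : ∀ I : Ideal R, I.FG → IsWFPProjective R I)
    {J : Ideal R} (hJ : IsGVIdeal J) : J = ⊤ := by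
  by_contra hne
  obtain ⟨m, hm, hJm⟩ := J.exists_le_maximal hne
  obtain ⟨b, hb, s, hs, h⟩ := exists_notMem_mul_eq_of_fg H hJ (hm := hm.isPrime) hJm J hJ.1
  have hs0 : s ≠ 0 := fun h0 => hs (h0 ▸ m.zero_mem)
  have hb0 : b ≠ 0 := by
    rintro rfl
    refine one_ne_zero (hJ.eq_zero (x := (1 : R)) fun a ha => ?_)
    obtain ⟨c, hc⟩ := h a ha
    rw [mul_one]
    exact (mul_eq_zero.1 (hc.trans (mul_zero c))).resolve_left hs0
  choose c hc using fun x : J => h x x.2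
  -- The map `x ↦ s * x / b`; being multiplication by some `r`, it gives `s = r * b ∈ m`.
  let φ : J →ₗ[R] R :=
    { toFun := c
      map_add' := fun x y => mul_right_cancel₀ hb0 (by
        rw [add_mul, ← hc, ← hc, ← hc, Submodule.coe_add, mul_add])
      map_smul' := fun r x => mul_right_cancel₀ hb0 (by
        rw [RingHom.id_apply, smul_eq_mul, mul_assoc, ← hc, ← hc, Submodule.coe_smul,
          smul_eq_mul, mul_left_comm]) }
  obtain ⟨r, hr⟩ := hJ.2.2 φ
  have h1 : r * b = c ⟨b, hb⟩ := LinearMap.congr_fun hr ⟨b, hb⟩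
  have h2 : s = r * b := mul_right_cancel₀ hb0 ((hc ⟨b, hb⟩).trans (by rw [h1]))
  exact hs (h2 ▸ m.mul_mem_left r (hJm hb))

end Main
end WFP

theorem mainTheorem6 (R : Type u) [CommRing R] [IsDomain R] :
    (WFP.IsCoherent R ∧ WFP.IsDWRing R) ↔
      ∀ (M : Type u) [AddCommGroup M] [Module R M], Module.Finite R M →
        Module.IsTorsionFree R M → WFP.IsWFPProjective R M := by
  constructor
  · rintro ⟨hc, hd⟩ M _ _ _ _
    obtain ⟨n, f, hf⟩ := WFP.exists_injective_pi (R := R) M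
    have := hc.finitePresentation_of_injective_pi n M f hf
    exact hd.isWFPProjective_of_finitePresentation M
  · intro h
    have H : ∀ I : Ideal R, I.FG → WFP.IsWFPProjective R I := fun I hI =>
      h I (Module.Finite.iff_fg.2 hI) inferInstance
    exact ⟨WFP.isCoherent_of_isWFPProjective H,
      WFP.isDWRing_of_gv_eq_top fun J hJ => hJ.eq_top_of_isWFPProjective H⟩
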